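/- Let $(W_k)_{k\ge 1}$ be i.i.d. real random variables with finite moments of every order, $\mathbb E[W_1]=0$, $\mathbb E[W_1^2]=1$, and cumulants $\kappa_r(W_1)\neq 0$ for $r=2,\dots,q+1$, where $q\ge 2$. Let $\alpha_{\infty,1},\dots,\alpha_{\infty,q}$ be non-zero, pairwise distinct real numbers with $\sum_{k=1}^q\alpha_{\infty,k}^2=1$, and put $F_\infty=\sum_{k=1}^q\alpha_{\infty,k}W_k$. Assume that $$\dim_{\mathbb Q}\operatorname{span}_{\mathbb Q}\{\alpha_{\infty,1}^2,\dots,\alpha_{\infty,q}^2\}=q,$$ i.e. that $\alpha_{\infty,1}^2,\dots,\alpha_{\infty,q}^2$ are linearly independent over $\mathbb Q$. Then there is a constant $C>0$, depending only on the target $F_\infty$ (that is, on $q$, on the coefficients $\alpha_{\infty,k}$ and on the law of $W_1$), such that the following holds for all real $(\alpha_{n,k})_{n,k\ge1}$ with $\sum_{k\ge1}\alpha_{n,k}^2=1$ for every $n$. Put $F_n=\sum_{k\ge1}\alpha_{n,k}W_k$ (a series converging in $L^2$) and $$\Delta(F_n)=\sum_{k\ge1}\alpha_{n,k}^2\prod_{r=1}^q(\alpha_{n,k}-\alpha_{\infty,r})^2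 .$$ Then $$W_2(F_n,F_\infty)\le C\sqrt{\Delta(F_n)}\qquad\text{for all } n\ge1,$$ where $W_2(X,Y)=\inf_\pi\big(\int|x-y|^2\,d\pi(x,y)\big)^{1/2}$, the infimum being over all probability measures $\pi$ on $\mathbb R^2$ whose marginals are the laws of $X$ and $Y$. In particular, if $\Delta(F_n)\to0$ as $n\to\infty$, then $F_n$ converges in distribution to $F_\infty$. -/

import Mathlib

open MeasureTheory ProbabilityTheory Filter Topology
open scoped ENNReal

namespace WienerChaosW2

/-- The couplings of two laws: the probability measures on the product with the given marginals. -/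
def couplings {E : Type*} [MeasurableSpace E] (μ ν : Measure E) : Set (Measure (E × E)) :=
  {π | IsProbabilityMeasure π ∧ π.fst = μ ∧ π.snd = ν}

/-- The Wasserstein distance of order `p` between two laws, with values in `[0, ∞]`:
the infimum over all couplings `π` of `(∫ d(x, y) ^ p dπ(x, y)) ^ (1 / p)`. -/
noncomputable def wasserstein {E : Type*} [MeasurableSpace E] [PseudoEMetricSpace E]
    (p : ℝ) (μ ν : Measure E) : ℝ≥0∞ :=
  ⨅ π ∈ couplings μ ν, (∫⁻ z, edist z.1 z.2 ^ p ∂π) ^ (1 / p)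

/-- The cumulant of order `r` of a law `μ` on the real line:
`(-i) ^ r` times the `r`-th derivative at `0` of the logarithm of the characteristic function.
This number is real when `μ` has a finite moment of order `r`, which is what the real part is for;
near `0` the characteristic function is close to `1`, so the principal branch is the right one. -/
noncomputable def cumulant (r : ℕ) (μ : Measure ℝ) : ℝ :=
  ((-Complex.I) ^ r * iteratedDeriv r (fun t : ℝ => Complex.log (charFun μ t)) 0).re

/-- `F` is the random variable `∑ k, a k * W k`, the series converging in `L²`. -/
def IsL2Sum {Ω : Type*} [MeasurableSpace Ω] (P : Measure Ω) (a : ℕ → ℝ) (W : ℕ → Ω → ℝ)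
    (F : Ω → ℝ) : Prop :=
  AEStronglyMeasurable F P ∧
    Tendsto (fun N : ℕ => eLpNorm (fun ω => F ω - ∑ k ∈ Finset.range N, a k * W k ω) 2 P)
      atTop (𝓝 0)

/-- The quantity `Δ = ∑ k, (a k) ^ 2 * ∏ r, (a k - b r) ^ 2` attached to the coefficients `a` of
an approximating random variable and to the coefficients `b` of the target. -/
noncomputable def Delta {q : ℕ} (b : Fin q → ℝ) (a : ℕ → ℝ) : ℝ :=
  ∑' k, a k ^ 2 * ∏ r, (a k - b r) ^ 2

end WienerChaosW2

/-! A term of `Delta` vanishes only if the coefficient is `0` or some `b r`. Quantitatively, a term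
dominates a fixed multiple of `(a k - b r) ^ 2` near `b r` and of `a k ^ 2` away from all `b r`
(`pow_mul_sq_le_of_near`, `pow_mul_sq_le_of_far`). So a small `Delta` puts `a` close in `ℓ²` to a
sequence with values `0` and `b r`, each `b r` taken `m r` times. Both squared norms being `1`, `∑ m
r * b r ^ 2` is close to `∑ b r ^ 2`. The `m r` are bounded, so rational independence forces `m r =
1` (`exists_multiplicity_gap`, `existsUnique_near`). For `Delta` bounded below the estimate is
trivial. Finally `∑ b r * W (σ r)` has the law of the target for every injective `σ`, and the `W k`
are orthonormal: coupling through the same `W` turns the `ℓ²` bound into the `W₂` bound. -/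

namespace WienerChaosW2

/-! ### Coefficient sequences: `ℓ²` stability under small `Delta`. -/

section Deterministic

variable {q : ℕ}

/-- The coefficient of index `k` in the series `∑ r, b r * W (σ r)`. -/
noncomputable def transport (b : Fin q → ℝ) (σ : Fin q → ℕ) (k : ℕ) : ℝ :=
  ∑ r, if σ r = k then b r else 0

lemma transport_apply {b : Fin q → ℝ} {σ : Fin q → ℕ} (hσ : Function.Injective σ) (r : Fin q) :
    transport b σ (σ r) = b r := by
  simp [transport, hσ.eq_iff]

lemma transport_of_notMem {b : Fin q → ℝ} {σ : Fin q → ℕ} {k : ℕ} (hk : ∀ r, σ r ≠ k) :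
    transport b σ k = 0 := by
  simp [transport, hk]

lemma transport_sq {b : Fin q → ℝ} {σ : Fin q → ℕ} (hσ : Function.Injective σ) (k : ℕ) :
    transport b σ k ^ 2 = transport (fun r => b r ^ 2) σ k := by
  by_cases h : ∃ r, σ r = k
  · obtain ⟨r, rfl⟩ := h
    rw [transport_apply hσ, transport_apply hσ]
  · push Not at h
    rw [transport_of_notMem h, transport_of_notMem h]
    norm_num

lemma hasSum_transport (b : Fin q → ℝ) (σ : Fin q → ℕ) :
    HasSum (transport b σ) (∑ r, b r) := by
  refine hasSum_sum fun r _ => ?_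
  convert! hasSum_ite_eq (σ r) (b r) using 3
  exact eq_comm

lemma sum_range_mul_transport (b : Fin q → ℝ) (σ : Fin q → ℕ) (w : ℕ → ℝ) {N : ℕ}
    (hN : ∀ r, σ r < N) :
    ∑ k ∈ Finset.range N, transport b σ k * w k = ∑ r, b r * w (σ r) := by
  simp only [transport, Finset.sum_mul]
  rw [Finset.sum_comm]
  refine Finset.sum_congr rfl fun r _ => ?_
  simp [ite_mul, Finset.sum_ite_eq, hN r]

/-- The factor `2` makes the `δ`-balls around the `b r` disjoint and keeps each at distance `δ` from
`0` and from the other `b s`. -/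
lemma exists_separation {b : Fin q → ℝ} (hb_ne : ∀ k, b k ≠ 0) (hb_inj : Function.Injective b) :
    ∃ δ : ℝ, 0 < δ ∧ (∀ r, 2 * δ ≤ |b r|) ∧ ∀ r s, r ≠ s → 2 * δ ≤ |b r - b s| := by
  have key : ∀ c : ℝ, 0 < c → ∀ᶠ δ in 𝓝[>] (0 : ℝ), 2 * δ ≤ c := fun c hc => by
    filter_upwards [Ioo_mem_nhdsGT (half_pos hc)] with δ hδ
    linarith [hδ.2]
  have h1 : ∀ᶠ δ in 𝓝[>] (0 : ℝ), ∀ r, 2 * δ ≤ |b r| :=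
    eventually_all.2 fun r => key _ (abs_pos.2 (hb_ne r))
  have h2 : ∀ᶠ δ in 𝓝[>] (0 : ℝ), ∀ r s, r ≠ s → 2 * δ ≤ |b r - b s| :=
    eventually_all.2 fun r => eventually_all.2 fun s => by
      by_cases hrs : r = s
      · simp [hrs]
      · filter_upwards [key _ (abs_pos.2 (sub_ne_zero.2 (hb_inj.ne hrs)))] with δ hδ _ using hδ
  obtain ⟨δ, ⟨h1, h2⟩, hδ⟩ := ((h1.and h2).and self_mem_nhdsWithin).exists
  exact ⟨δ, hδ, h1, h2⟩

/-- Among bounded multiplicities, only the multiplicity `1` reproduces approximately the total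
mass of a rationally independent family. -/
lemma exists_multiplicity_gap {c : Fin q → ℝ} (hc : LinearIndependent ℚ c) (B : ℕ) :
    ∃ ε : ℝ, 0 < ε ∧ ∀ m : Fin q → ℕ, (∀ r, m r ≤ B) →
      |∑ r, c r - ∑ r, (m r : ℝ) * c r| < ε → ∀ r, m r = 1 := by
  have hfin : (Set.Iic (fun _ : Fin q => B)).Finite := Set.finite_Iic _
  have h : ∀ᶠ ε in 𝓝[>] (0 : ℝ), ∀ m ∈ Set.Iic (fun _ : Fin q => B),
      |∑ r, c r - ∑ r, (m r : ℝ) * c r| < ε → ∀ r, m r = 1 := by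
    refine (eventually_all_finite hfin).2 fun m _ => ?_
    by_cases hm : ∑ r, c r - ∑ r, (m r : ℝ) * c r = 0
    · refine Eventually.of_forall fun ε _ r => ?_
      -- An exact coincidence of masses is a rational relation; the finitely many other `m` have a
      -- positive gap.
      have h0 : ∑ r, ((1 : ℚ) - m r) • c r = 0 := by
        rw [← hm, ← Finset.sum_sub_distrib]
        refine Finset.sum_congr rfl fun r _ => ?_
        rw [Rat.smul_def]
        push_cast
        ring
      have := Fintype.linearIndependent_iff.1 hc _ h0 r
      have h1 : (m r : ℚ) = 1 := by linarith
      exact_mod_cast h1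
    · filter_upwards [Ioo_mem_nhdsGT (abs_pos.2 hm)] with ε hε h
      exact absurd h hε.2.not_gt
  obtain ⟨ε, h, hε⟩ := (h.and self_mem_nhdsWithin).exists
  exact ⟨ε, hε, fun m hm => h m hm⟩

/-- Besides `(x - b r) ^ 2` there remain `q` factors, `x ^ 2` and the `q - 1` others, each at least
`δ ^ 2`. -/
lemma pow_mul_sq_le_of_near {b : Fin q → ℝ} {δ x : ℝ} (hδ : 0 < δ) (hb0 : ∀ r, 2 * δ ≤ |b r|)
    (hb : ∀ r s, r ≠ s → 2 * δ ≤ |b r - b s|) {r : Fin q} (hx : |x - b r| < δ) :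
    (δ ^ 2) ^ q * (x - b r) ^ 2 ≤ x ^ 2 * ∏ s, (x - b s) ^ 2 := by
  have hx0 : δ ^ 2 ≤ x ^ 2 := by
    rw [sq_le_sq, abs_of_pos hδ]
    have := abs_sub_abs_le_abs_sub (b r) x
    rw [abs_sub_comm] at this
    linarith [hb0 r]
  have hs : ∀ s ∈ Finset.univ.erase r, δ ^ 2 ≤ (x - b s) ^ 2 := fun s hs => by
    rw [sq_le_sq, abs_of_pos hδ]
    have h1 := abs_sub_le (b r) x (b s)
    rw [abs_sub_comm (b r) x] at h1
    linarith [hb r s (Finset.ne_of_mem_erase hs).symm]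
  have hprod : (δ ^ 2) ^ (q - 1) ≤ ∏ s ∈ Finset.univ.erase r, (x - b s) ^ 2 := by
    have := Finset.prod_le_prod (s := Finset.univ.erase r) (fun _ _ => sq_nonneg δ) hs
    simpa using this
  rw [← Finset.mul_prod_erase Finset.univ _ (Finset.mem_univ r)]
  have hq : q = (q - 1) + 1 := by have := r.pos; omega
  have hq' : (δ ^ 2) ^ q = δ ^ 2 * (δ ^ 2) ^ (q - 1) := by
    conv_lhs => rw [hq]
    rw [pow_succ']
  calc (δ ^ 2) ^ q * (x - b r) ^ 2 = (δ ^ 2 * (δ ^ 2) ^ (q - 1)) * (x - b r) ^ 2 := by rw [hq']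
    _ ≤ (x ^ 2 * ∏ s ∈ Finset.univ.erase r, (x - b s) ^ 2) * (x - b r) ^ 2 := by gcongr
    _ = _ := by ring

lemma pow_mul_sq_le_of_far {b : Fin q → ℝ} {δ x : ℝ} (hδ : 0 < δ)
    (hx : ∀ r, δ ≤ |x - b r|) :
    (δ ^ 2) ^ q * x ^ 2 ≤ x ^ 2 * ∏ s, (x - b s) ^ 2 := by
  have hs : ∀ s ∈ Finset.univ, δ ^ 2 ≤ (x - b s) ^ 2 := fun s _ => by
    rw [sq_le_sq, abs_of_pos hδ]
    exact hx s
  have hprod : (δ ^ 2) ^ q ≤ ∏ s, (x - b s) ^ 2 := by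
    have := Finset.prod_le_prod (s := Finset.univ) (fun _ _ => sq_nonneg δ) hs
    simpa using this
  rw [mul_comm]
  gcongr

lemma abs_le_one_of_hasSum_sq {a : ℕ → ℝ} (ha : HasSum (fun k => a k ^ 2) 1) (k : ℕ) :
    |a k| ≤ 1 := by
  have := le_hasSum ha k fun j _ => sq_nonneg (a j)
  rw [abs_le_one_iff_mul_self_le_one]
  nlinarith

lemma abs_le_one_of_sum_sq {b : Fin q → ℝ} (hb : ∑ k, b k ^ 2 = 1) (r : Fin q) : |b r| ≤ 1 := by
  have := Finset.single_le_sum (f := fun k => b k ^ 2) (fun j _ => sq_nonneg (b j))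
    (Finset.mem_univ r)
  rw [abs_le_one_iff_mul_self_le_one]
  nlinarith

lemma hasSum_Delta {b : Fin q → ℝ} (hb : ∑ k, b k ^ 2 = 1) {a : ℕ → ℝ}
    (ha : HasSum (fun k => a k ^ 2) 1) :
    HasSum (fun k => a k ^ 2 * ∏ r, (a k - b r) ^ 2) (Delta b a) := by
  refine Summable.hasSum (Summable.of_nonneg_of_le (fun k => by positivity) (fun k => ?_)
    (ha.summable.mul_right (4 ^ q)))
  have h : ∀ r ∈ Finset.univ, (a k - b r) ^ 2 ≤ 4 := fun r _ => by
    have h1 := abs_le.1 (abs_le_one_of_hasSum_sq ha k)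
    have h2 := abs_le.1 (abs_le_one_of_sum_sq hb r)
    nlinarith
  have := Finset.prod_le_prod (s := Finset.univ) (fun r _ => sq_nonneg (a k - b r)) h
  simp only [Finset.prod_const, Finset.card_univ, Fintype.card_fin] at this
  gcongr

/-- If the discrepancy is small, exactly one coefficient of the series is near each coefficient
of the target. -/
lemma existsUnique_near {b : Fin q → ℝ} (hb : ∑ k, b k ^ 2 = 1)
    (hlin : LinearIndependent ℚ fun k => b k ^ 2) {δ : ℝ} (hδ : 0 < δ)
    (hb0 : ∀ r, 2 * δ ≤ |b r|) (hsep : ∀ r s, r ≠ s → 2 * δ ≤ |b r - b s|) :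
    ∃ η : ℝ, 0 < η ∧ ∀ a : ℕ → ℝ, HasSum (fun k => a k ^ 2) 1 → Delta b a < η →
      ∀ r, ∃! k, |a k - b r| < δ := by
  obtain ⟨ε, hε, hgap⟩ := exists_multiplicity_gap hlin ⌊1 / δ ^ 2⌋₊
  set B := ⌊1 / δ ^ 2⌋₊
  have hK : 0 < (δ ^ 2) ^ q := by positivity
  -- Error budget: at most `q * B` near indices cost `2 * t` each, and all far ones together cost `t
  -- ^ 2`.
  obtain ⟨t, ht0, htε⟩ : ∃ t : ℝ, 0 < t ∧ 2 * t * (q * B) + t ^ 2 < ε := by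
    have hc : ContinuousAt (fun t : ℝ => 2 * t * (q * B) + t ^ 2) 0 := by fun_prop
    have h1 : ∀ᶠ t in 𝓝[>] (0 : ℝ), 2 * t * (q * B) + t ^ 2 < ε :=
      (hc.eventually_lt continuousAt_const (by simpa using hε)).filter_mono nhdsWithin_le_nhds
    obtain ⟨t, h1, h2⟩ := (h1.and self_mem_nhdsWithin).exists
    exact ⟨t, h2, h1⟩
  refine ⟨(δ ^ 2) ^ q * t ^ 2, by positivity, fun a ha hΔ => ?_⟩
  have hΔsum := hasSum_Delta hb ha
  have hfar0 : ∀ r k, |a k - b r| < δ → δ ^ 2 ≤ a k ^ 2 := fun r k hk => by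
    rw [sq_le_sq, abs_of_pos hδ]
    have := abs_sub_abs_le_abs_sub (b r) (a k)
    rw [abs_sub_comm] at this
    linarith [hb0 r]
  have hfin : ∀ r, {k | |a k - b r| < δ}.Finite := fun r => by
    have h1 := ha.summable.tendsto_cofinite_zero.eventually (gt_mem_nhds (pow_pos hδ 2))
    refine (Filter.eventually_cofinite.1 h1).subset fun k hk => ?_
    exact not_lt.2 (hfar0 r k hk)
  let S : Fin q → Finset ℕ := fun r => (hfin r).toFinset
  have hS : ∀ r k, k ∈ S r ↔ |a k - b r| < δ := fun r k => by simp [S]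
  -- Each near index carries mass at least `δ ^ 2` out of a total of `1`.
  have hcard : ∀ r, (S r).card ≤ B := fun r => by
    refine Nat.le_floor ?_
    rw [le_div_iff₀ (by positivity)]
    calc ((S r).card : ℝ) * δ ^ 2 = ∑ k ∈ S r, δ ^ 2 := by simp
      _ ≤ ∑ k ∈ S r, a k ^ 2 := Finset.sum_le_sum fun k hk => hfar0 r k ((hS r k).1 hk)
      _ ≤ 1 := sum_le_hasSum _ (fun k _ => sq_nonneg (a k)) ha
  have hind : ∀ (r : Fin q) (c : ℝ),
      HasSum (fun k => if k ∈ S r then c else 0) ((S r).card * c) := fun r c => by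
    have := hasSum_sum_of_ne_finset_zero (f := fun k => if k ∈ S r then c else 0) (s := S r)
      (L := SummationFilter.unconditional ℕ)
      (fun k hk => by simp [hk])
    simpa [Finset.sum_ite_mem] using this
  have hd : HasSum (fun k => ∑ r, if k ∈ S r then b r ^ 2 else 0)
      (∑ r, ((S r).card : ℝ) * b r ^ 2) := hasSum_sum fun r _ => hind r _
  have he : HasSum (fun k => ∑ r, if k ∈ S r then (2 * t) else 0)
      (∑ r, ((S r).card : ℝ) * (2 * t)) := hasSum_sum fun r _ => hind r _
  have hbound := he.add (hΔsum.mul_left ((δ ^ 2) ^ q)⁻¹)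
  have hT : ∀ k, 0 ≤ a k ^ 2 * ∏ r, (a k - b r) ^ 2 := fun k => by positivity
  have hpt : ∀ k, |a k ^ 2 - ∑ r, (if k ∈ S r then b r ^ 2 else 0)| ≤
      (∑ r, if k ∈ S r then (2 * t) else 0) +
        ((δ ^ 2) ^ q)⁻¹ * (a k ^ 2 * ∏ r, (a k - b r) ^ 2) := fun k => by
    by_cases hk : ∃ r, k ∈ S r
    · obtain ⟨r, hr⟩ := hk
      have hne : ∀ s, s ≠ r → k ∉ S s := fun s hs hks => by
        have h1 := (hS r k).1 hr
        have h2 := (hS s k).1 hks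
        have h3 := abs_sub_le (b r) (a k) (b s)
        rw [abs_sub_comm (b r) (a k)] at h3
        linarith [hsep r s hs.symm]
      have hsum : ∀ c : Fin q → ℝ, (∑ s, if k ∈ S s then c s else 0) = c r := fun c => by
        rw [Finset.sum_eq_single r (fun s _ hs => if_neg (hne s hs)) (by simp), if_pos hr]
      rw [hsum, hsum fun _ => 2 * t]
      have h1 : |a k - b r| ≤ t := by
        have h2 := pow_mul_sq_le_of_near hδ hb0 hsep ((hS r k).1 hr)
        have h3 := le_hasSum hΔsum k fun j _ => hT j
        have h4 : (a k - b r) ^ 2 ≤ t ^ 2 := le_of_mul_le_mul_left (h2.trans (h3.trans hΔ.le)) hK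
        exact abs_le_of_sq_le_sq h4 ht0.le
      have h2 : |a k + b r| ≤ 2 := (abs_add_le _ _).trans
        (by linarith [abs_le_one_of_hasSum_sq ha k, abs_le_one_of_sum_sq hb r])
      have h3 : |a k ^ 2 - b r ^ 2| ≤ 2 * t := by
        rw [sq_sub_sq, abs_mul]
        exact mul_le_mul h2 h1 (abs_nonneg _) zero_le_two
      have := mul_nonneg (inv_nonneg.2 hK.le) (hT k)
      linarith
    · push Not at hk
      have h1 := pow_mul_sq_le_of_far (b := b) (x := a k) hδ
        fun r => not_lt.1 fun h => hk r ((hS r k).2 h)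
      simp only [hk, if_false, Finset.sum_const_zero, sub_zero, zero_add, abs_sq]
      rwa [le_inv_mul_iff₀ hK]
  have hmain : |∑ r, b r ^ 2 - ∑ r, ((S r).card : ℝ) * b r ^ 2| < ε := by
    rw [hb]
    have h1 : |1 - ∑ r, ((S r).card : ℝ) * b r ^ 2| ≤
        ∑ r, ((S r).card : ℝ) * (2 * t) + ((δ ^ 2) ^ q)⁻¹ * Delta b a :=
      abs_le.2 ⟨hasSum_le (fun k => (abs_le.1 (hpt k)).1) hbound.neg (ha.sub hd),
        hasSum_le (fun k => (abs_le.1 (hpt k)).2) (ha.sub hd) hbound⟩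
    have h2 : ∑ r, ((S r).card : ℝ) * (2 * t) ≤ 2 * t * (q * B) := by
      calc ∑ r, ((S r).card : ℝ) * (2 * t) ≤ ∑ _r : Fin q, (B : ℝ) * (2 * t) := by
            refine Finset.sum_le_sum fun r _ => ?_
            have := hcard r
            gcongr
        _ = 2 * t * (q * B) := by simp; ring
    have h3 : ((δ ^ 2) ^ q)⁻¹ * Delta b a ≤ t ^ 2 := by
      rw [inv_mul_le_iff₀ hK]
      exact hΔ.le
    linarith
  intro r
  obtain ⟨k, hk⟩ := Finset.card_eq_one.1 (hgap _ hcard hmain r)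
  refine ⟨k, (hS r k).1 (by simp [hk]), fun j hj => ?_⟩
  have := (hS r j).2 hj
  rwa [hk, Finset.mem_singleton] at this

/-- The coefficients of the series are, up to a permutation, close in `ℓ²` to those of the
target, with an error controlled by the discrepancy. -/
theorem exists_transport_sq_le {b : Fin q → ℝ} (hb_ne : ∀ k, b k ≠ 0)
    (hb_inj : Function.Injective b) (hb : ∑ k, b k ^ 2 = 1)
    (hlin : LinearIndependent ℚ fun k => b k ^ 2) :
    ∃ L : ℝ, 0 < L ∧ ∀ a : ℕ → ℝ, HasSum (fun k => a k ^ 2) 1 →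
      ∃ σ : Fin q → ℕ, Function.Injective σ ∧
        ∀ N, ∑ k ∈ Finset.range N, (a k - transport b σ k) ^ 2 ≤ L * Delta b a := by
  obtain ⟨δ, hδ, hb0, hsep⟩ := exists_separation hb_ne hb_inj
  obtain ⟨η, hη, hnear⟩ := existsUnique_near hb hlin hδ hb0 hsep
  have hK : 0 < (δ ^ 2) ^ q := by positivity
  refine ⟨((δ ^ 2) ^ q)⁻¹ + 4 / η, by positivity, fun a ha => ?_⟩
  have hΔsum := hasSum_Delta hb ha
  have hT : ∀ k, 0 ≤ a k ^ 2 * ∏ r, (a k - b r) ^ 2 := fun k => by positivity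
  have hΔ0 : 0 ≤ Delta b a := hΔsum.nonneg hT
  rcases lt_or_ge (Delta b a) η with hΔ | hΔ
  · choose σ hσ hσu using hnear a ha hΔ
    simp only at hσ hσu
    have hσinj : Function.Injective σ := fun r s hrs => by
      by_contra hne
      have h1 := hσ r
      have h2 := hσ s
      rw [← hrs] at h2
      have h3 := abs_sub_le (b r) (a (σ r)) (b s)
      rw [abs_sub_comm (b r) (a (σ r))] at h3
      linarith [hsep r s hne]
    refine ⟨σ, hσinj, fun N => ?_⟩
    have hpt : ∀ k, (a k - transport b σ k) ^ 2 ≤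
        ((δ ^ 2) ^ q)⁻¹ * (a k ^ 2 * ∏ r, (a k - b r) ^ 2) := fun k => by
      rw [le_inv_mul_iff₀ hK]
      by_cases hk : ∃ r, σ r = k
      · obtain ⟨r, rfl⟩ := hk
        rw [transport_apply hσinj]
        exact pow_mul_sq_le_of_near hδ hb0 hsep (hσ r)
      · push Not at hk
        rw [transport_of_notMem hk, sub_zero]
        exact pow_mul_sq_le_of_far hδ fun r => not_lt.1 fun h => hk r (hσu r k h).symm
    calc ∑ k ∈ Finset.range N, (a k - transport b σ k) ^ 2
        ≤ ∑ k ∈ Finset.range N, ((δ ^ 2) ^ q)⁻¹ * (a k ^ 2 * ∏ r, (a k - b r) ^ 2) :=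
          Finset.sum_le_sum fun k _ => hpt k
      _ ≤ ((δ ^ 2) ^ q)⁻¹ * Delta b a :=
          sum_le_hasSum _ (fun k _ => mul_nonneg (inv_nonneg.2 hK.le) (hT k))
            (hΔsum.mul_left _)
      _ ≤ _ := by
          have : 0 ≤ 4 / η * Delta b a := by positivity
          linarith
  -- Large discrepancy: any injection works, since two unit vectors are at squared distance at most
  -- `4`.
  · refine ⟨Fin.val, Fin.val_injective, fun N => ?_⟩
    have hc : HasSum (fun k => transport b Fin.val k ^ 2) 1 := by
      simp only [transport_sq (b := b) Fin.val_injective]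
      rw [← hb]
      exact hasSum_transport _ _
    have hsum : HasSum (fun k => 2 * (a k ^ 2 + transport b Fin.val k ^ 2)) (2 * (1 + 1)) :=
      (ha.add hc).mul_left 2
    calc ∑ k ∈ Finset.range N, (a k - transport b Fin.val k) ^ 2
        ≤ ∑ k ∈ Finset.range N, 2 * (a k ^ 2 + transport b Fin.val k ^ 2) :=
          Finset.sum_le_sum fun k _ => by nlinarith [sq_nonneg (a k + transport b Fin.val k)]
      _ ≤ 2 * (1 + 1) := sum_le_hasSum _ (fun k _ => by positivity) hsum
      _ = 4 / η * η := by field_simp; norm_num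
      _ ≤ 4 / η * Delta b a := by gcongr
      _ ≤ _ := by
          have : 0 ≤ ((δ ^ 2) ^ q)⁻¹ * Delta b a := by positivity
          linarith

end Deterministic

/-! ### From `ℓ²` bounds to couplings. -/

section Probabilistic

variable {Ω : Type*} [MeasurableSpace Ω] {P : Measure Ω}
  {μ : Measure ℝ} {W : ℕ → Ω → ℝ}

lemma memLp_two_of_hasLaw (hμ_var : ∫ x, x ^ 2 ∂μ = 1) {X : Ω → ℝ} (hX : HasLaw X μ P) :
    MemLp X 2 P := by
  -- A non-integrable function has integral `0` by convention, so a second moment equal to `1`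
  -- already gives integrability.
  have h : MemLp id 2 μ :=
    (memLp_two_iff_integrable_sq (by fun_prop)).2
      (.of_integral_ne_zero (by simp [hμ_var]))
  rw [← hX.map_eq] at h
  exact (memLp_map_measure_iff (by fun_prop) hX.aemeasurable).1 h

variable [IsProbabilityMeasure P]

lemma eLpNorm_sum_range (hμ_mean : ∫ x, x ∂μ = 0) (hμ_var : ∫ x, x ^ 2 ∂μ = 1)
    (hind : iIndepFun W P) (hlaw : ∀ k, HasLaw (W k) μ P) (d : ℕ → ℝ) (N : ℕ) :
    eLpNorm (fun ω => ∑ k ∈ Finset.range N, d k * W k ω) 2 P =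
      ENNReal.ofReal √(∑ k ∈ Finset.range N, d k ^ 2) := by
  have hW : ∀ k, MemLp (W k) 2 P := fun k => memLp_two_of_hasLaw hμ_var (hlaw k)
  have hdW : ∀ k, MemLp (fun ω => d k * W k ω) 2 P := fun k => (hW k).const_mul (d k)
  have hS : MemLp (fun ω => ∑ k ∈ Finset.range N, d k * W k ω) 2 P :=
    memLp_finsetSum _ fun k _ => hdW k
  have hmean : ∀ k, ∫ ω, W k ω ∂P = 0 := fun k => by
    rw [← hμ_mean, ← (hlaw k).map_eq, integral_map (hlaw k).aemeasurable (by fun_prop)]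
  have hsq : ∀ k, ∫ ω, W k ω ^ 2 ∂P = 1 := fun k => by
    rw [← hμ_var, ← (hlaw k).map_eq, integral_map (hlaw k).aemeasurable (by fun_prop)]
  have hvar : ∀ k, Var[fun ω => d k * W k ω; P] = d k ^ 2 := fun k => by
    rw [variance_const_mul, variance_eq_sub (hW k)]
    simp [hmean, hsq]
  have hV : Var[∑ k ∈ Finset.range N, fun ω => d k * W k ω; P] =
      ∑ k ∈ Finset.range N, d k ^ 2 := by
    rw [IndepFun.variance_sum (fun k _ => hdW k) fun i _ j _ hij => ?_]
    · exact Finset.sum_congr rfl fun k _ => hvar k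
    · exact (hind.indepFun hij).comp (measurable_const_mul (d i)) (measurable_const_mul (d j))
  have hfun : (∑ k ∈ Finset.range N, fun ω => d k * W k ω) =
      fun ω => ∑ k ∈ Finset.range N, d k * W k ω := by
    ext ω
    simp
  have hzero : ∫ ω, ∑ k ∈ Finset.range N, d k * W k ω ∂P = 0 := by
    rw [integral_finsetSum _ fun k _ => (hdW k).integrable one_le_two]
    simp [integral_const_mul, hmean]
  rw [hfun, variance_of_integral_eq_zero hS.aemeasurable hzero] at hV
  rw [hS.eLpNorm_eq_integral_rpow_norm two_ne_zero ENNReal.ofNat_ne_top, ← hV, Real.sqrt_eq_rpow]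
  simp

/-- A uniform bound on the coefficients in `ℓ²` passes to the `L²` sum. -/
lemma eLpNorm_sub_le {q : ℕ} (hμ_mean : ∫ x, x ∂μ = 0) (hμ_var : ∫ x, x ^ 2 ∂μ = 1)
    (hind : iIndepFun W P) (hlaw : ∀ k, HasLaw (W k) μ P) {a : ℕ → ℝ} {F : Ω → ℝ}
    (hF : IsL2Sum P a W F) (b : Fin q → ℝ) (σ : Fin q → ℕ) {D : ℝ}
    (hD : ∀ N, ∑ k ∈ Finset.range N, (a k - transport b σ k) ^ 2 ≤ D) :
    eLpNorm (fun ω => F ω - ∑ r, b r * W (σ r) ω) 2 P ≤ ENNReal.ofReal √D := by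
  have hmeas : ∀ k, AEStronglyMeasurable (W k) P := fun k =>
    (hlaw k).aemeasurable.aestronglyMeasurable
  have hlim := hF.2.add_const (ENNReal.ofReal √D)
  rw [zero_add] at hlim
  refine ge_of_tendsto hlim ?_
  -- Beyond every `σ r`, the partial sum contains the whole transported target.
  obtain ⟨N₀, hN₀⟩ : ∃ N₀, ∀ r, σ r < N₀ :=
    ⟨Finset.univ.sup σ + 1, fun r => Nat.lt_succ_of_le (Finset.le_sup (Finset.mem_univ r))⟩
  filter_upwards [eventually_ge_atTop N₀] with N hN
  have hsplit : (fun ω => F ω - ∑ r, b r * W (σ r) ω) =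
      (fun ω => F ω - ∑ k ∈ Finset.range N, a k * W k ω) +
        fun ω => ∑ k ∈ Finset.range N, (a k - transport b σ k) * W k ω := by
    ext ω
    simp only [Pi.add_apply, sub_mul, Finset.sum_sub_distrib]
    rw [sum_range_mul_transport b σ (fun k => W k ω) fun r => (hN₀ r).trans_le hN]
    ring
  rw [hsplit]
  have h1 : AEStronglyMeasurable (fun ω => ∑ k ∈ Finset.range N, a k * W k ω) P :=
    Finset.aestronglyMeasurable_fun_sum _ fun k _ => (hmeas k).const_mul _
  have h2 : AEStronglyMeasurable
      (fun ω => ∑ k ∈ Finset.range N, (a k - transport b σ k) * W k ω) P :=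
    Finset.aestronglyMeasurable_fun_sum _ fun k _ => (hmeas k).const_mul _
  refine (eLpNorm_add_le (hF.1.sub h1) h2 one_le_two).trans ?_
  refine add_le_add le_rfl ?_
  rw [eLpNorm_sum_range hμ_mean hμ_var hind hlaw]
  exact ENNReal.ofReal_le_ofReal (Real.sqrt_le_sqrt (hD N))

lemma map_linearCombination_eq {q : ℕ} (hind : iIndepFun W P) (hlaw : ∀ k, HasLaw (W k) μ P)
    (b : Fin q → ℝ) {σ τ : Fin q → ℕ} (hσ : Function.Injective σ) (hτ : Function.Injective τ) :
    P.map (fun ω => ∑ r, b r * W (σ r) ω) = P.map (fun ω => ∑ r, b r * W (τ r) ω) := by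
  have hae : ∀ k, AEMeasurable (W k) P := fun k => (hlaw k).aemeasurable
  have key : ∀ ρ : Fin q → ℕ, Function.Injective ρ →
      P.map (fun ω => ∑ r, b r * W (ρ r) ω) =
        (Measure.pi fun _ : Fin q => μ).map (fun x => ∑ r, b r * x r) := fun ρ hρ => by
    have h := (iIndepFun_iff_map_fun_eq_pi_map fun r => hae (ρ r)).1 (hind.precomp hρ)
    simp only [(hlaw _).map_eq] at h
    have hlin : Measurable fun x : Fin q → ℝ => ∑ r, b r * x r := by fun_prop
    rw [← h, AEMeasurable.map_map_of_aemeasurable hlin.aemeasurable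
      (aemeasurable_pi_lambda _ fun r => hae (ρ r))]
    rfl
  rw [key σ hσ, key τ hτ]

/-- The Wasserstein distance of order two is at most the `L²` distance of any two random
variables with the given laws. -/
lemma wasserstein_two_map_le {X Y : Ω → ℝ} (hX : AEMeasurable X P) (hY : AEMeasurable Y P) :
    wasserstein 2 (P.map X) (P.map Y) ≤ eLpNorm (fun ω => X ω - Y ω) 2 P := by
  have hXY : AEMeasurable (fun ω => (X ω, Y ω)) P := hX.prodMk hY
  refine (iInf₂_le (P.map fun ω => (X ω, Y ω)) ⟨Measure.isProbabilityMeasure_map hXY,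
    Measure.fst_map_prodMk₀ hY, Measure.snd_map_prodMk₀ hX⟩).trans_eq ?_
  rw [lintegral_map' (by fun_prop) hXY,
    eLpNorm_eq_lintegral_rpow_enorm_toReal two_ne_zero ENNReal.ofNat_ne_top]
  simp [edist_eq_enorm_sub]

end Probabilistic

end WienerChaosW2

/-- The target is `F∞ = ∑ k < q, b k * W k` and the approximating sequence is
`F n = ∑ k, a n k * W k`, where `W` is an i.i.d. sequence with common law `μ`. The constant `C`
depends only on `q`, `b` and `μ`. -/
theorem theorem3p4
    (q : ℕ) (hq : 2 ≤ q)
    (b : Fin q → ℝ) (hb_ne : ∀ k, b k ≠ 0) (hb_inj : Function.Injective b)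
    (hb_norm : ∑ k, b k ^ 2 = 1)
    (hb_dim : Module.finrank ℚ (Submodule.span ℚ (Set.range fun k => b k ^ 2)) = q)
    (μ : Measure ℝ) [IsProbabilityMeasure μ]
    (hμ_mom : ∀ r : ℕ, Integrable (fun x : ℝ => x ^ r) μ)
    (hμ_mean : ∫ x, x ∂μ = 0) (hμ_var : ∫ x, x ^ 2 ∂μ = 1)
    (hμ_cum : ∀ r : ℕ, 2 ≤ r → r ≤ q + 1 → WienerChaosW2.cumulant r μ ≠ 0) :
    ∃ C : ℝ, 0 < C ∧
      ∀ {Ω : Type*} [MeasurableSpace Ω] (P : Measure Ω) [IsProbabilityMeasure P]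
        (W : ℕ → Ω → ℝ), iIndepFun W P → (∀ k, HasLaw (W k) μ P) →
      ∀ (a : ℕ → ℕ → ℝ), (∀ n, HasSum (fun k => a n k ^ 2) 1) →
      ∀ (F : ℕ → Ω → ℝ), (∀ n, WienerChaosW2.IsL2Sum P (a n) W (F n)) →
      ∀ (Finf : Ω → ℝ), (Finf = fun ω => ∑ k : Fin q, b k * W k ω) →
        (∀ n, WienerChaosW2.wasserstein 2 (P.map (F n)) (P.map Finf)
            ≤ ENNReal.ofReal (C * √(WienerChaosW2.Delta b (a n)))) ∧
        (Tendsto (fun n => WienerChaosW2.Delta b (a n)) atTop (𝓝 0) →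
          TendstoInDistribution F atTop Finf (fun _ => P) P) := by
  have hlin : LinearIndependent ℚ fun k => b k ^ 2 := by
    rw [linearIndependent_iff_card_eq_finrank_span, Set.finrank, hb_dim, Fintype.card_fin]
  obtain ⟨L, hL, key⟩ := WienerChaosW2.exists_transport_sq_le hb_ne hb_inj hb_norm hlin
  refine ⟨√L, Real.sqrt_pos.2 hL, ?_⟩
  intro Ω _ P _ W hind hlaw a ha F hF Finf hFinf
  subst hFinf
  choose σ hσ hbound using fun n => key (a n) (ha n)
  have hG : ∀ ρ : Fin q → ℕ, AEMeasurable (fun ω => ∑ r, b r * W (ρ r) ω) P := fun ρ =>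
    Finset.aemeasurable_fun_sum _ fun r _ => (hlaw _).aemeasurable.const_mul _
  have hmap : ∀ n, P.map (fun ω => ∑ r, b r * W (σ n r) ω) =
      P.map (fun ω => ∑ k : Fin q, b k * W k ω) := fun n =>
    WienerChaosW2.map_linearCombination_eq hind hlaw b (hσ n) Fin.val_injective
  have hL2 : ∀ n, eLpNorm (fun ω => F n ω - ∑ r, b r * W (σ n r) ω) 2 P ≤
      ENNReal.ofReal (√L * √(WienerChaosW2.Delta b (a n))) := fun n => by
    rw [← Real.sqrt_mul hL.le]
    exact WienerChaosW2.eLpNorm_sub_le hμ_mean hμ_var hind hlaw (hF n) b (σ n) (hbound n)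
  refine ⟨fun n => ?_, fun hΔ => ?_⟩
  · rw [← hmap n]
    exact (WienerChaosW2.wasserstein_two_map_le (hF n).1.aemeasurable (hG _)).trans (hL2 n)
  -- The comparison variables depend on `n` but their law does not, so `L²` closeness suffices.
  · refine tendstoInDistribution_of_tendstoInMeasure_sub
      (X := fun n ω => ∑ r, b r * W (σ n r) ω) F _ ⟨fun n => hG _, hG _, ?_⟩ ?_
      fun n => (hF n).1.aemeasurable
    · simp only [hmap]
      exact tendsto_const_nhds
    · refine tendstoInMeasure_of_tendsto_eLpNorm two_ne_zero
        (fun n => (hF n).1.sub (hG _).aestronglyMeasurable) aestronglyMeasurable_zero ?_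
      have hlim : Tendsto (fun n => ENNReal.ofReal (√L * √(WienerChaosW2.Delta b (a n)))) atTop
          (𝓝 0) := by
        have h : Tendsto (fun n => √L * √(WienerChaosW2.Delta b (a n))) atTop (𝓝 0) := by
          simpa using (hΔ.sqrt.const_mul √L)
        simpa using ENNReal.tendsto_ofReal h
      refine tendsto_of_tendsto_of_tendsto_of_le_of_le tendsto_const_nhds hlim
        (fun n => zero_le) fun n => ?_
      simpa using! hL2 n
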